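/- For a finite simple graph $X$ with adjacency matrix $A$ and diagonal degree matrix $D$, and for $q\in\mathbb{R}$, let $M_q=qD+A$ and $U_{M_q}(t)=e^{itM_q}$. A vertex $u$ of $X$ is sedentary with respect to $M_q$ if $\inf_{t>0}|U_{M_q}(t)_{u,u}|\ge C$ for some constant $0<C\le 1$. A complete multipartite graph is a graph $K_{n_1,\ldots,n_k}=O_{n_1}\vee\cdots\vee O_{n_k}$ with $k\ge 1$ and all $n_j\ge 1$, where $O_m$ is the edgeless graph on $m$ vertices and $\vee$ is the join. A connected threshold graph is a graph of the form $((((O_{m_1}\vee K_{m_2})\cup O_{m_3})\vee K_{m_4})\cdots)\vee K_{m_{2k}}$ with $k\ge 1$, or $((((K_{m_1}\cup O_{m_2})\vee K_{m_3})\cup O_{m_4})\cdots)\vee K_{m_{2k+1}}$ with $k\ge 0$, with all $m_j\ge 1$. A threshold graph is a graph obtained from a single vertex by repeatedly adding either an isolated vertex or a vertex adjacent to all previous vertices. Let $\mathcal{F}$ be the class of complete multipartite graphs, the class of connected threshold graphs, or the class of all threshold graphs. Then almost all graphs in $\mathcal{F}$ contain a vertex that is sedentary with respect to $M_q$ for every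 $q\in\mathbb{R}$. That is, if $f(n)$ is the number of isomorphism classes of graphs in $\mathcal{F}$ on $n$ vertices, and $g(n)$ is the number of those isomorphism classes whose graphs have a vertex $u$ such that, for every $q\in\mathbb{R}$, $u$ is sedentary with respect to $M_q$, then $$\lim_{n\to\infty}\frac{g(n)}{f(n)}=1.$$ -/

import Mathlib

open Filter Topology

noncomputable section

namespace Sedentary

/-- The generalized adjacency matrix `M_q = q D + A` of a simple graph. -/
def genAdjMatrix {V : Type} [Fintype V] [DecidableEq V] (G : SimpleGraph V)
    [DecidableRel G.Adj] (q : ℝ) : Matrix V V ℝ :=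
  q • G.degMatrix ℝ + G.adjMatrix ℝ

/-- The transition matrix `U(t) = exp (i t M)` of the continuous-time quantum walk with
Hamiltonian `M`. -/
def transition {V : Type} [Fintype V] [DecidableEq V] (M : Matrix V V ℝ) (t : ℝ) :
    Matrix V V ℂ :=
  NormedSpace.exp ((Complex.I * (t : ℂ)) • M.map (fun x : ℝ => (x : ℂ)))

/-- The vertex `u` is `C`-sedentary with respect to `M`: `0 < C ≤ 1` and
`inf_{t > 0} |U(t)_{u,u}| ≥ C`. -/
def IsCSedentary {V : Type} [Fintype V] [DecidableEq V] (M : Matrix V V ℝ) (u : V) (C : ℝ) :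
    Prop :=
  0 < C ∧ C ≤ 1 ∧ C ≤ ⨅ t : Set.Ioi (0 : ℝ), ‖transition M (t : ℝ) u u‖

/-- The vertex `u` is sedentary with respect to `M`. -/
def IsSedentary {V : Type} [Fintype V] [DecidableEq V] (M : Matrix V V ℝ) (u : V) : Prop :=
  ∃ C : ℝ, IsCSedentary M u C

open Classical in
/-- The graph has a vertex that is sedentary with respect to `M_q` for every real `q`. -/
def HasSedentaryVertex {V : Type} [Fintype V] (G : SimpleGraph V) : Prop :=
  ∃ u : V, ∀ q : ℝ, IsSedentary (genAdjMatrix G q) u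

/-- `G` is a complete multipartite graph `K_{n_1,…,n_k}` (with `k` nonempty parts; one single
part, the edgeless graph, is allowed, so that the graphs on `n` vertices up to isomorphism
correspond to the partitions of `n`). -/
def IsCompleteMultipartite {V : Type} (G : SimpleGraph V) : Prop :=
  ∃ (k : ℕ) (m : Fin k → ℕ), (∀ j, 0 < m j) ∧
    Nonempty (G ≃g SimpleGraph.completeMultipartiteGraph (fun j : Fin k => Fin (m j)))

/-- The join of two graphs: their disjoint union together with all edges between them. -/
def graphJoin {V W : Type} (G : SimpleGraph V) (H : SimpleGraph W) : SimpleGraph (V ⊕ W) :=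
  (G ⊕g H) ⊔ completeBipartiteGraph V W

/-- Vertex type of the graphs `thresholdGraph b l`: a disjoint union of cells of sizes `l`. -/
def ThresholdVertex : List ℕ → Type
  | [] => Empty
  | m :: l => ThresholdVertex l ⊕ Fin m

/-- Alternating joins with complete graphs and disjoint unions with edgeless graphs. The list
holds the sizes of the cells, the one added last standing first, and the Boolean says whether the
last step is a join (`true`) or a disjoint union (`false`):
`thresholdGraph true [m_h, …, m_1] = (((… ) ∪ O_{m_{h-1}}) ∨ K_{m_h})`, whose innermost cell is
`O_{m_1}` if `h` is even and `K_{m_1}` if `h` is odd. -/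
def thresholdGraph : Bool → (l : List ℕ) → SimpleGraph (ThresholdVertex l)
  | _, [] => (⊥ : SimpleGraph Empty)
  | true, m :: l => graphJoin (thresholdGraph false l) (⊤ : SimpleGraph (Fin m))
  | false, m :: l => thresholdGraph true l ⊕g (⊥ : SimpleGraph (Fin m))

/-- The graph `Γ(m_1, …, m_h) = (((… ) ∪ O_{m_{h-1}}) ∨ K_{m_h})`. -/
def Gam (m : List ℕ) : SimpleGraph (ThresholdVertex m.reverse) :=
  thresholdGraph true m.reverse

/-- `G` is a connected threshold graph: isomorphic to some `Γ(m_1, …, m_h)` with `h ≥ 1` and all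
`m_j ≥ 1`. -/
def IsConnectedThreshold {V : Type} (G : SimpleGraph V) : Prop :=
  ∃ m : List ℕ, m ≠ [] ∧ (∀ x ∈ m, 0 < x) ∧ Nonempty (G ≃g Gam m)

/-- `G` is a threshold graph, connected or not: it is obtained from a single vertex by repeatedly
adding an isolated vertex or a vertex adjacent to all previous ones. Equal consecutive additions
are grouped into cells, and the last operation is arbitrary. -/
def IsThreshold {V : Type} (G : SimpleGraph V) : Prop :=
  ∃ (b : Bool) (l : List ℕ), l ≠ [] ∧ (∀ x ∈ l, 0 < x) ∧ Nonempty (G ≃g thresholdGraph b l)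

/-- Isomorphism of graphs on the vertex set `Fin n`. -/
def isoSetoid (n : ℕ) : Setoid (SimpleGraph (Fin n)) where
  r G H := Nonempty (G ≃g H)
  iseqv :=
    { refl := fun _ => ⟨SimpleGraph.Iso.refl⟩
      symm := fun ⟨f⟩ => ⟨f.symm⟩
      trans := fun ⟨f⟩ ⟨g⟩ => ⟨g.comp f⟩ }

/-- The number of isomorphism classes of graphs on `n` vertices that have a member with the
property `P` (all properties used are invariant under isomorphism). -/
def isoCount (n : ℕ) (P : SimpleGraph (Fin n) → Prop) : ℕ :=
  (Quotient.mk (isoSetoid n) '' {G | P G}).ncard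

/-- Almost all graphs of the family `F` have the property `P`: among the isomorphism classes of
`n`-vertex graphs in `F`, the proportion of those with `P` tends to `1` as `n → ∞`. -/
def AlmostAll (F P : ∀ n : ℕ, SimpleGraph (Fin n) → Prop) : Prop :=
  Tendsto (fun n : ℕ => (isoCount n (fun G => F n G ∧ P n G) : ℝ) / (isoCount n (F n) : ℝ))
    atTop (𝓝 1)

end Sedentary

end

/-! If `a`, `b`, `c` are pairwise twins, then `e_a - e_b` and `e_a - e_c` are eigenvectors of `M_q`
for every `q`, so `U_aa - U_ab` and `U_aa - U_ac` have modulus 1. Since `U` is unitary, row `a` has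
norm 1, and with `x = |U_aa|` this gives `x² + 2(1 - x)² ≤ 1`, hence `x ≥ 1/3` at all times
(`isCSedentary_of_twins`).

It remains to see that graphs without three pairwise twins are rare. In a complete multipartite
graph, the vertices of one part are twins, and so are the vertices of singleton parts; avoiding a
triple leaves parts of size at most 2 and at most two singletons. That allows at most 3 classes on
`n` vertices, against at least `n` in all.

In a threshold graph each cell consists of twins, so avoiding a triple forces cells of size 1 or 2.
Such size sequences number at most `(7/4)^n`, a Fibonacci-type bound, whereas the connected
threshold graphs on `n ≥ 2` vertices already form at least `2^(n-2)` classes, told apart by their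
degrees (`IsReduced.eq_of_cellDegrees_eq`). -/

namespace Sedentary

/-! ### Eigenvectors and unitarity of the transition matrix -/

section Exponential

variable {V : Type} [Fintype V] [DecidableEq V]

theorem exp_mulVec_of_eigenvector {B : Matrix V V ℂ} {v : V → ℂ} {μ : ℂ}
    (h : B.mulVec v = μ • v) :
    (NormedSpace.exp B).mulVec v = Complex.exp μ • v := by
  -- The norm serves only to sum the exponential series.
  let _ : SeminormedRing (Matrix V V ℂ) := Matrix.linftyOpSemiNormedRing
  let _ : NormedRing (Matrix V V ℂ) := Matrix.linftyOpNormedRing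
  let _ : NormedAlgebra ℂ (Matrix V V ℂ) := Matrix.linftyOpNormedAlgebra
  have hpow : ∀ n : ℕ, (B ^ n).mulVec v = μ ^ n • v := by
    intro n
    induction n with
    | zero => simp
    | succ n ih =>
      rw [pow_succ, ← Matrix.mulVec_mulVec, h, Matrix.mulVec_smul, ih, smul_smul, pow_succ,
        mul_comm]
  have h1 := NormedSpace.exp_series_hasSum_exp' (𝕂 := ℂ) B
  have h2 : HasSum (fun n : ℕ => ((n.factorial : ℂ)⁻¹ • B ^ n).mulVec v)
      ((NormedSpace.exp B).mulVec v) :=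
    h1.map (Matrix.mulVec.addMonoidHomLeft v) (by
      change Continuous fun M : Matrix V V ℂ => M.mulVec v
      fun_prop)
  have h3 : HasSum (fun n : ℕ => ((n.factorial : ℂ)⁻¹ • μ ^ n) • v) (Complex.exp μ • v) := by
    rw [Complex.exp_eq_exp_ℂ]
    exact (NormedSpace.exp_series_hasSum_exp' (𝕂 := ℂ) μ).smul_const v
  refine h2.unique ?_
  convert h3 using 2 with n
  rw [Matrix.smul_mulVec, hpow, smul_assoc]

theorem transition_mul_conjTranspose {M : Matrix V V ℝ} (hM : M.IsSymm) (t : ℝ) :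
    transition M t * (transition M t).conjTranspose = 1 := by
  unfold transition
  set B := (Complex.I * (t : ℂ)) • M.map (fun x : ℝ => (x : ℂ)) with hB
  have hBs : B.conjTranspose = -B := by
    ext i j
    have := hM.apply i j
    simp [hB, this]
  rw [← Matrix.exp_conjTranspose, hBs, ← Matrix.exp_add_of_commute _ _ (Commute.refl B).neg_right]
  simp

theorem sum_norm_sq_transition {M : Matrix V V ℝ} (hM : M.IsSymm) (t : ℝ) (a : V) :
    ∑ v, ‖transition M t a v‖ ^ 2 = 1 := by
  have h := congrFun (congrFun (transition_mul_conjTranspose hM t) a) a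
  simp only [Matrix.mul_apply, Matrix.conjTranspose_apply, Matrix.one_apply_eq,
    RCLike.star_def, Complex.mul_conj, Complex.normSq_eq_norm_sq] at h
  exact_mod_cast h

theorem transition_sub_of_eigenvector {M : Matrix V V ℝ} {a b : V} (hab : a ≠ b) {θ : ℝ}
    (h : M.mulVec (Pi.single a 1 - Pi.single b 1) = θ • (Pi.single a 1 - Pi.single b 1)) (t : ℝ) :
    transition M t a a - transition M t a b = Complex.exp (Complex.I * (t * θ : ℝ)) := by
  have h1 : ((Complex.I * (t : ℂ)) • M.map (fun x : ℝ => (x : ℂ))).mulVec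
      (Pi.single a 1 - Pi.single b 1) =
      (Complex.I * (t * θ : ℝ)) • (Pi.single a 1 - Pi.single b 1 : V → ℂ) := by
    rw [Matrix.smul_mulVec]
    have h2 : (M.map (fun x : ℝ => (x : ℂ))).mulVec (Pi.single a 1 - Pi.single b 1) =
        (θ : ℂ) • (Pi.single a 1 - Pi.single b 1 : V → ℂ) := by
      ext v
      have := congrArg (fun x : ℝ => (x : ℂ)) (congrFun h v)
      simp only [Matrix.mulVec_sub, Matrix.mulVec_single_one, Pi.sub_apply, Matrix.col_apply,
        Pi.smul_apply, smul_eq_mul, Pi.single_apply, Matrix.map_apply] at this ⊢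
      push_cast at this
      split_ifs at this ⊢ <;> simpa using this
    rw [h2, smul_smul]
    push_cast
    ring_nf
  have h3 := congrFun (exp_mulVec_of_eigenvector h1) a
  simpa [Matrix.mulVec_sub, transition, hab] using h3

end Exponential

/-! ### Twin triples and sedentariness -/

/-- Two vertices have the same neighbours apart from themselves. -/
def IsTwin {V : Type} (G : SimpleGraph V) (a b : V) : Prop :=
  ∀ v, v ≠ a → v ≠ b → (G.Adj a v ↔ G.Adj b v)

/-- There are three distinct pairwise twin vertices. -/
def HasTwinTriple {V : Type} (G : SimpleGraph V) : Prop :=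
  ∃ a b c : V, a ≠ b ∧ a ≠ c ∧ b ≠ c ∧ IsTwin G a b ∧ IsTwin G a c

/-- Twins survive any extension whose new vertices do not distinguish the old ones; joins and
disjoint unions are of this kind. -/
theorem HasTwinTriple.of_embedding {V W : Type} {G : SimpleGraph V} {H : SimpleGraph W}
    (f : G ↪g H)
    (hf : ∀ x y, ∀ w ∉ Set.range f, H.Adj (f x) w ↔ H.Adj (f y) w)
    (h : HasTwinTriple G) : HasTwinTriple H := by
  have key : ∀ x y, IsTwin G x y → IsTwin H (f x) (f y) := by
    intro x y hxy w h1 h2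
    by_cases hw : w ∈ Set.range f
    · obtain ⟨z, rfl⟩ := hw
      rw [f.map_adj_iff, f.map_adj_iff]
      exact hxy z (fun e => h1 (e ▸ rfl)) (fun e => h2 (e ▸ rfl))
    · exact hf x y w hw
  obtain ⟨a, b, c, hab, hac, hbc, h1, h2⟩ := h
  exact ⟨f a, f b, f c, f.injective.ne hab, f.injective.ne hac, f.injective.ne hbc,
    key _ _ h1, key _ _ h2⟩

theorem HasTwinTriple.of_iso {V W : Type} {G : SimpleGraph V} {H : SimpleGraph W}
    (f : G ≃g H) (h : HasTwinTriple G) : HasTwinTriple H :=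
  h.of_embedding f.toEmbedding fun _ _ w hw => absurd (f.surjective w) hw

section Twins

variable {V : Type} [Fintype V] [DecidableEq V] {G : SimpleGraph V} [DecidableRel G.Adj]

theorem IsTwin.degree_eq {a b : V} (h : IsTwin G a b) : G.degree a = G.degree b := by
  rcases eq_or_ne a b with rfl | hab
  · rfl
  rw [← G.card_neighborFinset_eq_degree, ← G.card_neighborFinset_eq_degree]
  refine Finset.card_equiv (Equiv.swap a b) fun v => ?_
  simp only [SimpleGraph.mem_neighborFinset]
  rcases eq_or_ne v a with rfl | hva
  · simp
  rcases eq_or_ne v b with rfl | hvb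
  · simp [G.adj_comm]
  rw [Equiv.swap_apply_of_ne_of_ne hva hvb]
  exact h v hva hvb

theorem genAdjMatrix_isSymm (q : ℝ) : (genAdjMatrix G q).IsSymm := by
  unfold genAdjMatrix
  exact ((G.isSymm_degMatrix ℝ).smul q).add (G.isSymm_adjMatrix)

theorem IsTwin.genAdjMatrix_mulVec {a b : V} (hab : a ≠ b) (h : IsTwin G a b) (q : ℝ) :
    (genAdjMatrix G q).mulVec (Pi.single a 1 - Pi.single b 1) =
      (q * G.degree a - if G.Adj a b then 1 else 0) • (Pi.single a 1 - Pi.single b 1) := by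
  ext v
  simp only [genAdjMatrix, SimpleGraph.degMatrix, Matrix.mulVec_sub, Matrix.mulVec_single_one,
    Pi.sub_apply, Matrix.col_apply, Matrix.add_apply, Matrix.smul_apply, smul_eq_mul,
    SimpleGraph.adjMatrix_apply, Pi.smul_apply]
  rcases eq_or_ne v a with rfl | hva
  · simp [hab]
  rcases eq_or_ne v b with rfl | hvb
  · simp [hva, h.degree_eq, G.adj_comm]
  have := h v hva hvb
  simp [hva, hvb, G.adj_comm v, this]

theorem isCSedentary_of_twins {a b c : V} (hab : a ≠ b) (hac : a ≠ c) (hbc : b ≠ c)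
    (h₁ : IsTwin G a b) (h₂ : IsTwin G a c) (q : ℝ) :
    IsCSedentary (genAdjMatrix G q) a (1 / 3) := by
  refine ⟨by norm_num, by norm_num, ?_⟩
  have : Nonempty (Set.Ioi (0 : ℝ)) := ⟨⟨1, by simp⟩⟩
  refine le_ciInf fun t => ?_
  -- This makes the two eigenvalues coincide.
  have hadj : G.Adj a b ↔ G.Adj a c := by
    rw [h₂ b hab.symm hbc, h₁ c hac.symm hbc.symm, G.adj_comm]
  have e₁ := transition_sub_of_eigenvector hab (h₁.genAdjMatrix_mulVec hab q) t
  have e₂ := transition_sub_of_eigenvector hac (h₂.genAdjMatrix_mulVec hac q) t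
  simp only [← hadj] at e₂
  set lam := Complex.exp (Complex.I *
    (((t : ℝ) * (q * G.degree a - if G.Adj a b then 1 else 0) : ℝ) : ℂ)) with hlam
  have hl : ‖lam‖ = 1 := by rw [hlam, mul_comm, Complex.norm_exp_ofReal_mul_I]
  have hrow := sum_norm_sq_transition (genAdjMatrix_isSymm (G := G) q) t a
  set U := transition (genAdjMatrix G q) t with hU
  have hsub : ∑ v ∈ {a, b, c}, ‖U a v‖ ^ 2 ≤ 1 := by
    rw [← hrow]
    exact Finset.sum_le_sum_of_subset_of_nonneg (Finset.subset_univ _) fun _ _ _ => sq_nonneg _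
  rw [Finset.sum_insert (by simp [hab, hac]), Finset.sum_insert (by simp [hbc]),
    Finset.sum_singleton] at hsub
  have n₁ : 1 ≤ ‖U a a‖ + ‖U a b‖ := by
    rw [← hl, ← e₁]; exact norm_sub_le _ _
  have n₂ : 1 ≤ ‖U a a‖ + ‖U a c‖ := by
    rw [← hl, ← e₂]; exact norm_sub_le _ _
  have := norm_nonneg (U a a)
  -- With `x = ‖U a a‖ < 1/3`, the row sum is at least `x² + 2(1 - x)²`, which exceeds 1 because
  -- `(3x - 1)(x - 1) > 0`.
  by_contra hlt
  push Not at hlt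
  nlinarith [norm_nonneg (U a b), norm_nonneg (U a c)]

end Twins

theorem HasTwinTriple.hasSedentaryVertex {V : Type} [Fintype V] {G : SimpleGraph V}
    (h : HasTwinTriple G) : HasSedentaryVertex G := by
  classical
  obtain ⟨a, b, c, hab, hac, hbc, h₁, h₂⟩ := h
  exact ⟨a, fun q => ⟨1 / 3, isCSedentary_of_twins hab hac hbc h₁ h₂ q⟩⟩

end Sedentary

/-! ### Counting isomorphism classes -/

namespace Sedentary

theorem isoCount_mono {n : ℕ} {P Q : SimpleGraph (Fin n) → Prop} (h : ∀ G, P G → Q G) :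
    isoCount n P ≤ isoCount n Q :=
  Set.ncard_le_ncard (Set.image_mono h) (Set.toFinite _)

theorem isoCount_le_add (n : ℕ) (P Q : SimpleGraph (Fin n) → Prop) :
    isoCount n P ≤ isoCount n (fun G => P G ∧ Q G) + isoCount n (fun G => P G ∧ ¬ Q G) := by
  unfold isoCount
  refine le_trans (Set.ncard_le_ncard ?_ (Set.toFinite _)) (Set.ncard_union_le _ _)
  rw [← Set.image_union]
  refine Set.image_mono fun G hG => ?_
  by_cases hQ : Q G
  · exact Or.inl ⟨hG, hQ⟩
  · exact Or.inr ⟨hG, hQ⟩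

/-- If the graphs with `P` are determined up to isomorphism by a label from `T`, there are at most
`#T` isomorphism classes of them. -/
theorem isoCount_le_card {n : ℕ} {P : SimpleGraph (Fin n) → Prop} {ι : Type} (T : Finset ι)
    (R : ι → SimpleGraph (Fin n) → Prop) (hT : ∀ G, P G → ∃ t ∈ T, R t G)
    (hR : ∀ t G H, R t G → R t H → Nonempty (G ≃g H)) : isoCount n P ≤ T.card := by
  classical
  have key : ∀ c ∈ Quotient.mk (isoSetoid n) '' {G | P G},
      ∃ t ∈ T, ∃ G, Quotient.mk (isoSetoid n) G = c ∧ R t G := by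
    rintro _ ⟨G, hG, rfl⟩
    obtain ⟨t, ht, h⟩ := hT G hG
    exact ⟨t, ht, G, rfl, h⟩
  -- `choose!` needs a default label for the classes outside the image.
  rcases isEmpty_or_nonempty ι with hι | hι
  · have : Quotient.mk (isoSetoid n) '' {G | P G} = ∅ :=
      Set.eq_empty_of_forall_notMem fun c hc => hι.elim (key c hc).choose
    simp [isoCount, this]
  choose! f hfT hf using key
  rw [isoCount, ← Set.ncard_coe_finset T]
  refine Set.ncard_le_ncard_of_injOn f hfT ?_ T.finite_toSet
  intro c hc d hd hcd
  obtain ⟨G, rfl, hG⟩ := hf c hc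
  obtain ⟨H, rfl, hH⟩ := hf d hd
  rw [hcd] at hG
  exact Quotient.sound (s := isoSetoid n) (hR _ _ _ hG hH)

/-- A family of pairwise non-isomorphic graphs with `P` bounds the number of isomorphism classes
from below. -/
theorem card_le_isoCount {n : ℕ} {P : SimpleGraph (Fin n) → Prop} {ι : Type} [Fintype ι]
    (g : ι → SimpleGraph (Fin n)) (hP : ∀ i, P (g i))
    (hinj : ∀ i j, Nonempty (g i ≃g g j) → i = j) : Fintype.card ι ≤ isoCount n P := by
  rw [isoCount, ← Nat.card_eq_fintype_card, ← Set.ncard_univ]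
  refine Set.ncard_le_ncard_of_injOn (fun i => Quotient.mk (isoSetoid n) (g i))
    (fun i _ => ⟨g i, hP i, rfl⟩) (fun i _ j _ h => ?_) (Set.toFinite _)
  exact hinj i j (Quotient.exact (s := isoSetoid n) h)

/-- The ratio is squeezed between `1 - b n / l n` and 1. -/
theorem almostAll_of_bounds {F P : ∀ n : ℕ, SimpleGraph (Fin n) → Prop} {b l : ℕ → ℝ}
    (hb : ∀ n, (isoCount n (fun G => F n G ∧ ¬ P n G) : ℝ) ≤ b n)
    (hl : ∀ᶠ n in atTop, 0 < l n ∧ l n ≤ isoCount n (F n))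
    (hlim : Tendsto (fun n => b n / l n) atTop (𝓝 0)) : AlmostAll F P := by
  have h1 : Tendsto (fun n => 1 - b n / l n) atTop (𝓝 1) := by
    simpa using hlim.const_sub 1
  refine tendsto_of_tendsto_of_tendsto_of_le_of_le' h1 tendsto_const_nhds ?_ ?_
  · filter_upwards [hl] with n ⟨hpos, hle⟩
    have hf : (0 : ℝ) < isoCount n (F n) := hpos.trans_le hle
    have hsum : (isoCount n (F n) : ℝ) ≤ isoCount n (fun G => F n G ∧ P n G) +
        isoCount n (fun G => F n G ∧ ¬ P n G) := by
      exact_mod_cast isoCount_le_add n (F n) (P n)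
    have hbn : (isoCount n (fun G => F n G ∧ ¬ P n G) : ℝ) / isoCount n (F n) ≤ b n / l n :=
      div_le_div₀ ((Nat.cast_nonneg _).trans (hb n)) (hb n) hpos hle
    have h2 : (1 : ℝ) ≤ (isoCount n (fun G => F n G ∧ P n G) : ℝ) / isoCount n (F n) +
        (isoCount n (fun G => F n G ∧ ¬ P n G) : ℝ) / isoCount n (F n) := by
      rw [← add_div, one_le_div hf]
      exact hsum
    linarith
  · refine Eventually.of_forall fun n => div_le_one_of_le₀ ?_ (Nat.cast_nonneg _)
    have h : isoCount n (fun G => F n G ∧ P n G) ≤ isoCount n (F n) := isoCount_mono fun _ h => h.1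
    exact_mod_cast h

/-- Transport of a graph to the vertex set `Fin n`. -/
theorem exists_fin_iso {V : Type} [Fintype V] (G : SimpleGraph V) {n : ℕ}
    (h : Fintype.card V = n) : ∃ H : SimpleGraph (Fin n), Nonempty (H ≃g G) :=
  ⟨_, ⟨SimpleGraph.Iso.comap (Fintype.equivFinOfCardEq h).symm G⟩⟩

/-! ### Complete multipartite graphs -/

section Multipartite

open SimpleGraph

theorem hasTwinTriple_of_large_part {k : ℕ} {m : Fin k → ℕ} {j : Fin k} (h : 3 ≤ m j) :
    HasTwinTriple (completeMultipartiteGraph fun i => Fin (m i)) := by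
  refine ⟨⟨j, ⟨0, by omega⟩⟩, ⟨j, ⟨1, by omega⟩⟩, ⟨j, ⟨2, by omega⟩⟩, ?_, ?_, ?_, ?_, ?_⟩
  · simp
  · simp
  · simp
  · intro v _ _; simp [completeMultipartiteGraph]
  · intro v _ _; simp [completeMultipartiteGraph]

/-- Both vertices are adjacent to all others. -/
theorem isTwin_of_singleton_parts {k : ℕ} {m : Fin k → ℕ} {x y : Σ i, Fin (m i)}
    (hx : m x.1 = 1) (hy : m y.1 = 1) :
    IsTwin (completeMultipartiteGraph fun i => Fin (m i)) x y := by
  have key : ∀ z v : Σ i, Fin (m i), m z.1 = 1 → v ≠ z → z.1 ≠ v.1 := by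
    rintro ⟨i, a⟩ ⟨i', b⟩ h hne (rfl : i = i')
    have : Subsingleton (Fin (m i)) := by rw [h]; infer_instance
    exact hne (by rw [Subsingleton.elim a b])
  intro v h1 h2
  simp only [completeMultipartiteGraph, comap_adj, top_adj]
  exact iff_of_true (key x v hx h1) (key y v hy h2)

theorem hasTwinTriple_of_singleton_parts {k : ℕ} {m : Fin k → ℕ}
    (h : 2 < (Finset.univ.filter fun j => m j = 1).card) :
    HasTwinTriple (completeMultipartiteGraph fun i => Fin (m i)) := by
  obtain ⟨a, b, c, ha, hb, hc, hab, hac, hbc⟩ := Finset.two_lt_card_iff.1 h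
  simp only [Finset.mem_filter, Finset.mem_univ, true_and] at ha hb hc
  refine ⟨⟨a, ⟨0, by omega⟩⟩, ⟨b, ⟨0, by omega⟩⟩, ⟨c, ⟨0, by omega⟩⟩, ?_, ?_, ?_,
    isTwin_of_singleton_parts ha hb, isTwin_of_singleton_parts ha hc⟩
  · exact fun e => hab (congrArg Sigma.fst e)
  · exact fun e => hac (congrArg Sigma.fst e)
  · exact fun e => hbc (congrArg Sigma.fst e)

theorem completeMultipartite_iso_of_fibers {k k' : ℕ} {m : Fin k → ℕ} {m' : Fin k' → ℕ}
    (h : ∀ c, (Finset.univ.filter fun j => m j = c).card =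
      (Finset.univ.filter fun j => m' j = c).card) :
    Nonempty (completeMultipartiteGraph (fun i => Fin (m i)) ≃g
      completeMultipartiteGraph (fun i => Fin (m' i))) := by
  have e : ∀ c, {j // m j = c} ≃ {j // m' j = c} := fun c =>
    Fintype.equivOfCardEq (by simpa [Fintype.card_subtype] using h c)
  let σ : Fin k ≃ Fin k' :=
    (Equiv.sigmaFiberEquiv m).symm.trans
      ((Equiv.sigmaCongrRight e).trans (Equiv.sigmaFiberEquiv m'))
  have hσ : ∀ j, m j = m' (σ j) := fun j => (e (m j) ⟨j, rfl⟩).2.symm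
  refine ⟨⟨Equiv.sigmaCongr σ fun j => finCongr (hσ j), ?_⟩⟩
  intro x y
  exact not_congr (σ.injective.eq_iff (a := x.1) (b := y.1))

theorem sum_eq_ones_add_twos {k : ℕ} {m : Fin k → ℕ} (hpos : ∀ j, 0 < m j) (h2 : ∀ j, m j ≤ 2) :
    ∑ j, m j = (Finset.univ.filter fun j => m j = 1).card +
      2 * (Finset.univ.filter fun j => m j = 2).card := by
  rw [Finset.card_filter, Finset.card_filter, Finset.mul_sum, ← Finset.sum_add_distrib]
  refine Finset.sum_congr rfl fun j _ => ?_
  have := hpos j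
  have := h2 j
  interval_cases m j <;> simp

theorem card_eq_sum_of_iso {n k : ℕ} {m : Fin k → ℕ} {G : SimpleGraph (Fin n)}
    (f : G ≃g completeMultipartiteGraph fun i => Fin (m i)) : ∑ j, m j = n := by
  simpa using (Fintype.card_congr f.toEquiv).symm

theorem isoCount_multipartite_not_le (n : ℕ) :
    isoCount n (fun G => IsCompleteMultipartite G ∧ ¬ HasSedentaryVertex G) ≤ 3 := by
  have := isoCount_le_card (n := n)
    (P := fun G => IsCompleteMultipartite G ∧ ¬ HasSedentaryVertex G) (Finset.range 3)
    (fun a G => ∃ (k : ℕ) (m : Fin k → ℕ), (∀ j, 0 < m j) ∧ (∀ j, m j ≤ 2) ∧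
      (Finset.univ.filter fun j => m j = 1).card = a ∧
      Nonempty (G ≃g completeMultipartiteGraph fun i => Fin (m i))) ?_ ?_
  · simpa using this
  · rintro G ⟨⟨k, m, hpos, ⟨f⟩⟩, hG⟩
    have hno : ¬ HasTwinTriple (completeMultipartiteGraph fun i => Fin (m i)) := fun h =>
      hG (h.of_iso f.symm).hasSedentaryVertex
    refine ⟨_, ?_, k, m, hpos, fun j => ?_, rfl, ⟨f⟩⟩
    · by_contra hlt
      exact hno (hasTwinTriple_of_singleton_parts (by rw [Finset.mem_range] at hlt; omega))
    · by_contra hlt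
      exact hno (hasTwinTriple_of_large_part (j := j) (by omega))
  -- Given `n`, the number of parts of size 1 determines the number of parts of size 2, hence the
  -- graph.
  · rintro a G H ⟨k, m, hpos, h2, h1, ⟨f⟩⟩ ⟨k', m', hpos', h2', h1', ⟨f'⟩⟩
    have s := sum_eq_ones_add_twos hpos h2
    have s' := sum_eq_ones_add_twos hpos' h2'
    rw [card_eq_sum_of_iso f] at s
    rw [card_eq_sum_of_iso f'] at s'
    have key : ∀ c, (Finset.univ.filter fun j => m j = c).card =
        (Finset.univ.filter fun j => m' j = c).card := by
      intro c
      by_cases hc1 : c = 1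
      · rw [hc1, h1, h1']
      by_cases hc2 : c = 2
      · rw [hc2]; omega
      rw [Finset.card_eq_zero.2, Finset.card_eq_zero.2]
      · refine Finset.filter_eq_empty_iff.2 fun j _ => ?_
        have := hpos' j
        have := h2' j
        omega
      · refine Finset.filter_eq_empty_iff.2 fun j _ => ?_
        have := hpos j
        have := h2 j
        omega
    obtain ⟨e⟩ := completeMultipartite_iso_of_fibers key
    exact ⟨(f.trans e).trans f'.symm⟩

/-- The size of a vertex's part is its number of non-neighbours, itself included, which is an
isomorphism invariant. -/
theorem exists_part_of_iso {k k' : ℕ} {m : Fin k → ℕ} {m' : Fin k' → ℕ} (hpos : ∀ j, 0 < m j)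
    (f : completeMultipartiteGraph (fun i => Fin (m i)) ≃g
      completeMultipartiteGraph (fun i => Fin (m' i))) (j : Fin k) : ∃ j', m' j' = m j := by
  have key : ∀ {l : ℕ} (p : Fin l → ℕ) (x : Σ i, Fin (p i)), Nat.card
      {y // ¬ (completeMultipartiteGraph fun i => Fin (p i)).Adj x y} = p x.1 := by
    intro l p x
    let e : {y : Σ i, Fin (p i) // y.1 = x.1} ≃ Fin (p x.1) :=
      Equiv.sigmaSubtype x.1
    rw [← Nat.card_fin (p x.1)]
    refine Nat.card_congr (Equiv.trans (Equiv.subtypeEquivRight fun y => ?_) e)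
    simp [completeMultipartiteGraph, eq_comm]
  let x : Σ i, Fin (m i) := ⟨j, ⟨0, hpos j⟩⟩
  refine ⟨(f x).1, (key m' (f x)).symm.trans (Eq.trans ?_ (key m x))⟩
  refine Nat.card_congr (f.toEquiv.subtypeEquiv fun y => ?_).symm
  exact not_congr f.map_adj_iff.symm

theorem le_isoCount_multipartite (n : ℕ) :
    n ≤ isoCount n (fun G => IsCompleteMultipartite G) := by
  -- One part of size `j + 1` and `n - j - 1` singletons; the largest part size recovers `j`.
  let m : ∀ j : Fin n, Fin (n - j) → ℕ := fun j i => if (i : ℕ) = 0 then j + 1 else 1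
  have hpos : ∀ j i, 0 < m j i := by intro j i; simp only [m]; split_ifs <;> omega
  have hcard : ∀ j, Fintype.card (Σ i, Fin (m j i)) = n := by
    intro j
    obtain ⟨r, hr⟩ : ∃ r, n - (j : ℕ) = r + 1 := ⟨n - j - 1, by omega⟩
    simp only [Fintype.card_sigma, Fintype.card_fin, m]
    rw [Fin.sum_univ_eq_sum_range (fun i => if i = 0 then (j : ℕ) + 1 else 1) (n - j), hr,
      Finset.sum_range_succ']
    simp
    omega
  choose g hg using fun j => exists_fin_iso
    (completeMultipartiteGraph fun i => Fin (m j i)) (hcard j)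
  have := card_le_isoCount (P := fun G => IsCompleteMultipartite G) g
    (fun j => ⟨_, m j, hpos j, hg j⟩) ?_
  · simpa using this
  rintro i j ⟨f⟩
  obtain ⟨fi⟩ := hg i
  obtain ⟨fj⟩ := hg j
  have F := (fi.symm.trans f).trans fj
  have h1 : ∀ i : Fin n, m i ⟨0, by omega⟩ = i + 1 := fun i => by simp [m]
  obtain ⟨a, ha⟩ := exists_part_of_iso (hpos i) F ⟨0, by omega⟩
  obtain ⟨b, hb⟩ := exists_part_of_iso (hpos j) F.symm ⟨0, by omega⟩
  rw [h1] at ha hb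
  simp only [m] at ha hb
  split_ifs at ha hb <;> omega

theorem almostAll_multipartite : AlmostAll (fun _ G => IsCompleteMultipartite G)
    (fun _ G => HasSedentaryVertex G) := by
  refine almostAll_of_bounds (b := fun _ => 3) (l := fun n => n) (fun n => ?_) ?_ ?_
  · exact_mod_cast isoCount_multipartite_not_le n
  · filter_upwards [eventually_gt_atTop 0] with n hn
    exact ⟨by exact_mod_cast hn, by exact_mod_cast le_isoCount_multipartite n⟩
  · exact tendsto_const_nhds.div_atTop tendsto_natCast_atTop_atTop

end Multipartite

end Sedentary

namespace Sedentary

/-! ### Twins in threshold graphs -/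

section ThresholdTwins

theorem hasTwinTriple_graphJoin_left {V W : Type} {G : SimpleGraph V} (H : SimpleGraph W)
    (h : HasTwinTriple G) : HasTwinTriple (graphJoin G H) := by
  let f : G ↪g graphJoin G H := ⟨Function.Embedding.inl, by intro a b; simp [graphJoin]⟩
  refine h.of_embedding f fun x y w hw => ?_
  rcases w with w | w
  · exact absurd ⟨w, rfl⟩ hw
  · change (graphJoin G H).Adj (Sum.inl x) _ ↔ (graphJoin G H).Adj (Sum.inl y) _
    simp [graphJoin]

theorem hasTwinTriple_sum_left {V W : Type} {G : SimpleGraph V} (H : SimpleGraph W)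
    (h : HasTwinTriple G) : HasTwinTriple (G ⊕g H) := by
  let f : G ↪g (G ⊕g H) := ⟨Function.Embedding.inl, by intro a b; simp⟩
  refine h.of_embedding f fun x y w hw => ?_
  rcases w with w | w
  · exact absurd ⟨w, rfl⟩ hw
  · change (G ⊕g H).Adj (Sum.inl x) _ ↔ (G ⊕g H).Adj (Sum.inl y) _
    simp

theorem hasTwinTriple_of_isTwin_inr {V : Type} {m : ℕ} (hm : 3 ≤ m) {G : SimpleGraph (V ⊕ Fin m)}
    (h : ∀ i j : Fin m, IsTwin G (Sum.inr i) (Sum.inr j)) : HasTwinTriple G :=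
  ⟨Sum.inr ⟨0, by omega⟩, Sum.inr ⟨1, by omega⟩, Sum.inr ⟨2, by omega⟩, by simp, by simp, by simp,
    h _ _, h _ _⟩

theorem hasTwinTriple_thresholdGraph (b : Bool) (l : List ℕ) (h : ∃ x ∈ l, 3 ≤ x) :
    HasTwinTriple (thresholdGraph b l) := by
  induction l generalizing b with
  | nil => simp at h
  | cons m l ih =>
    by_cases hl : ∃ x ∈ l, 3 ≤ x
    · cases b with
      | true => exact hasTwinTriple_graphJoin_left _ (ih false hl)
      | false => exact hasTwinTriple_sum_left _ (ih true hl)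
    · have hm : 3 ≤ m := by
        obtain ⟨x, hx, h3⟩ := h
        rcases List.mem_cons.1 hx with rfl | hx
        · exact h3
        · exact absurd ⟨x, hx, h3⟩ hl
      cases b with
      | true =>
        refine hasTwinTriple_of_isTwin_inr (V := ThresholdVertex l) hm fun i j v h1 h2 => ?_
        change (graphJoin _ _).Adj _ _ ↔ (graphJoin _ _).Adj _ _
        rcases v with v | v
        · simp [graphJoin]
        · have h1' : i ≠ v := fun e => h1 (by rw [e])
          have h2' : j ≠ v := fun e => h2 (by rw [e])
          simp [graphJoin, h1', h2']
      | false =>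
        refine hasTwinTriple_of_isTwin_inr (V := ThresholdVertex l) hm fun i j v h1 h2 => ?_
        change (_ ⊕g _).Adj _ _ ↔ (_ ⊕g _).Adj _ _
        rcases v with v | v <;> simp

end ThresholdTwins

/-! ### Threshold graphs are determined by their degrees -/

section DegreeMultiset

/-- The multiset of vertex degrees. -/
noncomputable def degrees {V : Type} [Fintype V] (G : SimpleGraph V) : Multiset ℕ :=
  Finset.univ.val.map fun v => Nat.card {w // G.Adj v w}

theorem degrees_eq_of_iso {V W : Type} [Fintype V] [Fintype W] {G : SimpleGraph V}
    {H : SimpleGraph W} (f : G ≃g H) : degrees G = degrees H := by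
  unfold degrees
  rw [← Finset.map_univ_equiv f.toEquiv, Finset.map_val, Multiset.map_map]
  refine Multiset.map_congr rfl fun v _ => ?_
  exact Nat.card_congr (f.toEquiv.subtypeEquiv fun w => f.map_adj_iff.symm)

theorem card_subtype_sum {V W : Type} [Finite V] [Finite W] (p : V ⊕ W → Prop) :
    Nat.card {x // p x} = Nat.card {v // p (Sum.inl v)} + Nat.card {w // p (Sum.inr w)} := by
  rw [Nat.card_congr Equiv.subtypeSum, Nat.card_sum]

theorem degrees_sum_bot {V : Type} [Fintype V] (G : SimpleGraph V) (m : ℕ) :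
    degrees (G ⊕g (⊥ : SimpleGraph (Fin m))) = degrees G + Multiset.replicate m 0 := by
  unfold degrees
  rw [← Finset.univ_disjSum_univ, Finset.val_disjSum, Multiset.disjSum, Multiset.map_add,
    Multiset.map_map, Multiset.map_map]
  congr 1
  · refine Multiset.map_congr rfl fun v _ => ?_
    simp [card_subtype_sum]
  · refine (Multiset.map_congr rfl fun v _ => ?_).trans (Multiset.map_const' _ 0) |>.trans (by simp)
    simp [card_subtype_sum]

theorem degrees_graphJoin_top {V : Type} [Fintype V] (G : SimpleGraph V) (m : ℕ) :
    degrees (graphJoin G (⊤ : SimpleGraph (Fin m))) =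
      (degrees G).map (· + m) + Multiset.replicate m (Fintype.card V + (m - 1)) := by
  unfold degrees
  rw [← Finset.univ_disjSum_univ, Finset.val_disjSum, Multiset.disjSum, Multiset.map_add,
    Multiset.map_map, Multiset.map_map, Multiset.map_map]
  congr 1
  · refine Multiset.map_congr rfl fun v _ => ?_
    simp [card_subtype_sum, graphJoin]
  · refine (Multiset.map_congr rfl fun v _ => ?_).trans (Multiset.map_const' _
      (Fintype.card V + (m - 1))) |>.trans (by simp)
    simp [card_subtype_sum, graphJoin, Fintype.card_subtype_compl]

noncomputable instance thresholdVertexFintype : ∀ l : List ℕ, Fintype (ThresholdVertex l)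
  | [] => inferInstanceAs (Fintype Empty)
  | m :: l =>
    letI := thresholdVertexFintype l
    inferInstanceAs (Fintype (ThresholdVertex l ⊕ Fin m))

theorem card_thresholdVertex (l : List ℕ) : Fintype.card (ThresholdVertex l) = l.sum := by
  induction l with
  | nil => rfl
  | cons m l ih =>
    rw [List.sum_cons, add_comm, ← ih]
    exact (Fintype.card_sum (α := ThresholdVertex l) (β := Fin m)).trans (by simp)

/-- The degree multiset of `thresholdGraph b l`. -/
def cellDegrees : Bool → List ℕ → Multiset ℕ
  | _, [] => 0
  | true, m :: l => (cellDegrees false l).map (· + m) + Multiset.replicate m (l.sum + (m - 1))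
  | false, m :: l => cellDegrees true l + Multiset.replicate m 0

theorem degrees_thresholdGraph (b : Bool) (l : List ℕ) :
    degrees (thresholdGraph b l) = cellDegrees b l := by
  induction l generalizing b with
  | nil => cases b <;> rfl
  | cons m l ih =>
    cases b with
    | true =>
      rw [cellDegrees, ← ih false, ← card_thresholdVertex]
      exact degrees_graphJoin_top (thresholdGraph false l) m
    | false =>
      rw [cellDegrees, ← ih true]
      exact degrees_sum_bot (thresholdGraph true l) m

/-- The list of cell sizes is positive and its innermost cell has at least two vertices. -/
def IsReduced : List ℕ → Prop
  | [] => True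
  | m :: l => 0 < m ∧ IsReduced l ∧ (l = [] → 2 ≤ m)

theorem IsReduced.two_le_sum {l : List ℕ} (h : IsReduced l) (hl : l ≠ []) : 2 ≤ l.sum := by
  induction l with
  | nil => exact absurd rfl hl
  | cons m l ih =>
    obtain ⟨_, h2, h3⟩ := h
    rw [List.sum_cons]
    by_cases hl : l = []
    · have := h3 hl; omega
    · have := ih h2 hl; omega

theorem IsReduced.pos {l : List ℕ} (h : IsReduced l) : ∀ x ∈ l, 0 < x := by
  induction l with
  | nil => simp
  | cons m l ih =>
    intro x hx
    rcases List.mem_cons.1 hx with rfl | hx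
    · exact h.1
    · exact ih h.2.1 x hx

theorem lt_sum_of_mem_cellDegrees {b : Bool} {l : List ℕ} {x : ℕ} (hx : x ∈ cellDegrees b l) :
    x < l.sum := by
  induction l generalizing b x with
  | nil => simp [cellDegrees] at hx
  | cons m l ih =>
    rw [List.sum_cons]
    cases b with
    | true =>
      simp only [cellDegrees, Multiset.mem_add, Multiset.mem_map, Multiset.mem_replicate] at hx
      rcases hx with ⟨y, hy, rfl⟩ | ⟨hm, rfl⟩
      · have := ih hy; omega
      · omega
    | false =>
      simp only [cellDegrees, Multiset.mem_add, Multiset.mem_replicate] at hx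
      rcases hx with hx | ⟨hm, rfl⟩
      · have := ih hx; omega
      · omega

theorem IsReduced.pos_of_mem_cellDegrees_true {l : List ℕ} (h : IsReduced l) {x : ℕ}
    (hx : x ∈ cellDegrees true l) : 0 < x := by
  cases l with
  | nil => simp [cellDegrees] at hx
  | cons m l =>
    have h2 := h.two_le_sum (by simp)
    have hm := h.1
    rw [List.sum_cons] at h2
    simp only [cellDegrees, Multiset.mem_add, Multiset.mem_map, Multiset.mem_replicate] at hx
    rcases hx with ⟨y, hy, rfl⟩ | ⟨_, rfl⟩ <;> omega

theorem IsReduced.lt_of_mem_cellDegrees_false {l : List ℕ} (h : IsReduced l) {x : ℕ}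
    (hx : x ∈ cellDegrees false l) : x + 1 < l.sum := by
  cases l with
  | nil => simp [cellDegrees] at hx
  | cons m l =>
    have h2 := h.two_le_sum (by simp)
    have hm := h.1
    rw [List.sum_cons] at h2 ⊢
    simp only [cellDegrees, Multiset.mem_add, Multiset.mem_replicate] at hx
    rcases hx with hx | ⟨_, rfl⟩
    · have := lt_sum_of_mem_cellDegrees hx; omega
    · omega

theorem IsReduced.count_cellDegrees_false {m : ℕ} {l : List ℕ} (h : IsReduced (m :: l)) :
    (cellDegrees false (m :: l)).count 0 = m := by
  rw [cellDegrees, Multiset.count_add, Multiset.count_replicate_self, Multiset.count_eq_zero.2,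
    zero_add]
  exact fun h0 => absurd (h.2.1.pos_of_mem_cellDegrees_true h0) (lt_irrefl 0)

theorem IsReduced.count_cellDegrees_true {m : ℕ} {l : List ℕ} (h : IsReduced (m :: l)) :
    (cellDegrees true (m :: l)).count ((m :: l).sum - 1) = m := by
  have hm := h.1
  have e : (m :: l).sum - 1 = l.sum + (m - 1) := by rw [List.sum_cons]; omega
  rw [e, cellDegrees, Multiset.count_add, Multiset.count_replicate_self,
    Multiset.count_eq_zero.2, zero_add]
  intro h0
  obtain ⟨y, hy, hy'⟩ := Multiset.mem_map.1 h0
  have := h.2.1.lt_of_mem_cellDegrees_false hy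
  omega

/-- The outermost cell can be read off and peeled away: after a join it is the set of dominating
vertices, after a union the set of isolated ones. Reducedness is essential, since a one-vertex
innermost cell is both complete and edgeless and could be merged into the next cell. -/
theorem IsReduced.eq_of_cellDegrees_eq {b : Bool} {l l' : List ℕ} (h : IsReduced l)
    (h' : IsReduced l') (hs : l.sum = l'.sum) (hd : cellDegrees b l = cellDegrees b l') :
    l = l' := by
  induction l generalizing b l' with
  | nil =>
    by_contra hne
    have := h'.two_le_sum (Ne.symm hne)
    simp at hs
    omega
  | cons m l ih =>
    cases l' with
    | nil =>
      have := h.two_le_sum (by simp)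
      rw [hs] at this
      simp at this
    | cons m' l' =>
      have hm : m = m' := by
        cases b with
        | true => rw [← h.count_cellDegrees_true, hd, hs, h'.count_cellDegrees_true]
        | false => rw [← h.count_cellDegrees_false, hd, h'.count_cellDegrees_false]
      subst hm
      have hs' : l.sum = l'.sum := by simpa using hs
      congr 1
      cases b with
      | true =>
        rw [cellDegrees, cellDegrees, hs'] at hd
        exact ih h.2.1 h'.2.1 hs'
          (Multiset.map_injective (add_left_injective m) (add_right_cancel hd))
      | false =>
        rw [cellDegrees, cellDegrees] at hd
        exact ih h.2.1 h'.2.1 hs' (add_right_cancel hd)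

end DegreeMultiset

/-! ### Exponential bounds for threshold graphs -/

section Counting

/-- Increase the last entry of a list by one. -/
def bumpLast : List ℕ → List ℕ
  | [] => []
  | m :: l => (if l = [] then m + 1 else m) :: bumpLast l

theorem bumpLast_eq_nil_iff {l : List ℕ} : bumpLast l = [] ↔ l = [] := by
  cases l <;> simp [bumpLast]

theorem bumpLast_injective : Function.Injective bumpLast := by
  intro l l' h
  induction l generalizing l' with
  | nil => exact (bumpLast_eq_nil_iff.1 h.symm).symm
  | cons m l ih =>
    cases l' with
    | nil => exact bumpLast_eq_nil_iff.1 h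
    | cons m' l' =>
      rw [bumpLast, bumpLast, List.cons.injEq] at h
      obtain rfl := ih h.2
      have := h.1
      split_ifs at this <;> simp_all

theorem sum_bumpLast {l : List ℕ} (h : l ≠ []) : (bumpLast l).sum = l.sum + 1 := by
  induction l with
  | nil => exact absurd rfl h
  | cons m l ih =>
    by_cases hl : l = []
    · simp [hl, bumpLast]
    · simp [hl, bumpLast, ih hl, add_assoc]

theorem isReduced_bumpLast {l : List ℕ} (h : ∀ x ∈ l, 0 < x) : IsReduced (bumpLast l) := by
  induction l with
  | nil => trivial
  | cons m l ih =>
    have hm := h m (by simp)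
    refine ⟨by split_ifs <;> omega, ih fun x hx => h x (by simp [hx]), fun hl => ?_⟩
    rw [if_pos (bumpLast_eq_nil_iff.1 hl)]
    omega

/-- The lists with entries `1` and `2` and sum `n`. -/
def oneTwoLists : ℕ → Finset (List ℕ)
  | 0 => {[]}
  | 1 => {[1]}
  | n + 2 => (oneTwoLists (n + 1)).image (List.cons 1) ∪ (oneTwoLists n).image (List.cons 2)

theorem mem_oneTwoLists {l : List ℕ} (h : ∀ x ∈ l, 0 < x ∧ x ≤ 2) : l ∈ oneTwoLists l.sum := by
  induction l with
  | nil => simp [oneTwoLists]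
  | cons m l ih =>
    have hl := ih fun x hx => h x (by simp [hx])
    obtain ⟨h1, h2⟩ := h m (by simp)
    rw [List.sum_cons]
    interval_cases m
    · rcases hs : l.sum with _ | s
      · rw [hs] at hl
        simpa [oneTwoLists] using hl
      · rw [show 1 + (s + 1) = s + 2 by omega, oneTwoLists, ← hs]
        exact Finset.mem_union_left _ (Finset.mem_image_of_mem _ hl)
    · rw [add_comm, oneTwoLists]
      exact Finset.mem_union_right _ (Finset.mem_image_of_mem _ hl)

theorem card_oneTwoLists_le (n : ℕ) : ((oneTwoLists n).card : ℝ) ≤ (7 / 4) ^ n := by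
  induction n using Nat.twoStepInduction with
  | zero => simp [oneTwoLists]
  | one => simp [oneTwoLists]; norm_num
  | more n ih0 ih1 =>
    have h : (oneTwoLists (n + 2)).card ≤ (oneTwoLists (n + 1)).card + (oneTwoLists n).card :=
      (Finset.card_union_le _ _).trans (add_le_add Finset.card_image_le Finset.card_image_le)
    have h' : ((oneTwoLists (n + 2)).card : ℝ) ≤
        (oneTwoLists (n + 1)).card + (oneTwoLists n).card := by exact_mod_cast h
    have hp : (0 : ℝ) < (7 / 4) ^ n := by positivity
    rw [pow_succ] at ih1 ⊢
    rw [pow_succ]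
    -- The induction closes because `7/4 + 1 ≤ (7/4)²`; any base with this property below 2 would
    -- serve.
    linarith

theorem IsConnectedThreshold.isThreshold {V : Type} {G : SimpleGraph V}
    (h : IsConnectedThreshold G) : IsThreshold G := by
  obtain ⟨m, hm, hpos, e⟩ := h
  exact ⟨true, m.reverse, by simpa using hm, fun x hx => hpos x (by simpa using hx), e⟩

theorem isConnectedThreshold_of_iso {V : Type} {G : SimpleGraph V} {l : List ℕ} (hl : l ≠ [])
    (hpos : ∀ x ∈ l, 0 < x) (h : Nonempty (G ≃g thresholdGraph true l)) :
    IsConnectedThreshold G := by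
  refine ⟨l.reverse, by simpa using hl, fun x hx => hpos x (by simpa using hx), ?_⟩
  unfold Gam
  rwa [List.reverse_reverse]

theorem isoCount_threshold_not_le (n : ℕ) :
    (isoCount n (fun G => IsThreshold G ∧ ¬ HasSedentaryVertex G) : ℝ) ≤ 2 * (7 / 4) ^ n := by
  have h := isoCount_le_card (n := n) (P := fun G => IsThreshold G ∧ ¬ HasSedentaryVertex G)
    (Finset.univ ×ˢ oneTwoLists n)
    (fun (t : Bool × List ℕ) G => Nonempty (G ≃g thresholdGraph t.1 t.2)) ?_ ?_
  · rw [Finset.card_product] at h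
    calc (isoCount n (fun G => IsThreshold G ∧ ¬ HasSedentaryVertex G) : ℝ)
        ≤ 2 * (oneTwoLists n).card := by exact_mod_cast h
      _ ≤ 2 * (7 / 4) ^ n := by linarith [card_oneTwoLists_le n]
  · rintro G ⟨⟨b, l, -, hpos, ⟨f⟩⟩, hG⟩
    refine ⟨(b, l), ?_, ⟨f⟩⟩
    have hsum : l.sum = n := by
      rw [← card_thresholdVertex, ← Fintype.card_congr f.toEquiv, Fintype.card_fin]
    rw [Finset.mem_product, ← hsum]
    refine ⟨Finset.mem_univ _, mem_oneTwoLists fun x hx => ⟨hpos x hx, ?_⟩⟩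
    by_contra hlt
    exact hG ((hasTwinTriple_thresholdGraph b l ⟨x, hx, by omega⟩).of_iso
      f.symm).hasSedentaryVertex
  · rintro t G H ⟨f⟩ ⟨g⟩
    exact ⟨f.trans g.symm⟩

/-- The `2^n` compositions of `n + 1` become distinct reduced lists of sum `n + 2` once the
innermost cell is enlarged by one. -/
theorem le_isoCount_connectedThreshold (n : ℕ) :
    2 ^ n ≤ isoCount (n + 2) (fun G => IsConnectedThreshold G) := by
  have hne : ∀ c : Composition (n + 1), c.blocks ≠ [] := fun c h => by
    have := c.blocks_sum
    simp [h] at this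
  have hred : ∀ c : Composition (n + 1), IsReduced (bumpLast c.blocks) := fun c =>
    isReduced_bumpLast fun x hx => c.blocks_pos hx
  have hsum : ∀ c : Composition (n + 1), (bumpLast c.blocks).sum = n + 2 := fun c => by
    rw [sum_bumpLast (hne c), c.blocks_sum]
  choose g hg using fun c : Composition (n + 1) => exists_fin_iso
    (thresholdGraph true (bumpLast c.blocks)) ((card_thresholdVertex _).trans (hsum c))
  have h := card_le_isoCount (P := fun G => IsConnectedThreshold G) g (fun c =>
    isConnectedThreshold_of_iso (mt bumpLast_eq_nil_iff.1 (hne c)) (hred c).pos (hg c)) ?_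
  · simpa [composition_card] using h
  rintro c d ⟨f⟩
  obtain ⟨fc⟩ := hg c
  obtain ⟨fd⟩ := hg d
  have hd := degrees_eq_of_iso ((fc.symm.trans f).trans fd)
  rw [degrees_thresholdGraph, degrees_thresholdGraph] at hd
  exact Composition.ext (bumpLast_injective
    ((hred c).eq_of_cellDegrees_eq (hred d) ((hsum c).trans (hsum d).symm) hd))

/-- Exceptions are counted among all threshold graphs and the total among the connected ones alone,
so both families are handled at once. -/
theorem almostAll_of_threshold_family {F : ∀ n : ℕ, SimpleGraph (Fin n) → Prop}
    (h₁ : ∀ n G, IsConnectedThreshold G → F n G) (h₂ : ∀ n G, F n G → IsThreshold G) :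
    AlmostAll F (fun _ G => HasSedentaryVertex G) := by
  refine almostAll_of_bounds (b := fun n => 2 * (7 / 4) ^ n) (l := fun n => 2 ^ n / 4)
    (fun n => ?_) ?_ ?_
  · refine le_trans ?_ (isoCount_threshold_not_le n)
    exact_mod_cast isoCount_mono fun G (h : F n G ∧ ¬ HasSedentaryVertex G) =>
      (⟨h₂ n G h.1, h.2⟩ : IsThreshold G ∧ ¬ HasSedentaryVertex G)
  · filter_upwards [eventually_ge_atTop 2] with n hn
    obtain ⟨k, rfl⟩ := Nat.exists_eq_add_of_le' hn
    refine ⟨by positivity, ?_⟩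
    have h : 2 ^ k ≤ isoCount (k + 2) (F (k + 2)) :=
      (le_isoCount_connectedThreshold k).trans (isoCount_mono (h₁ (k + 2)))
    have h' : (2 : ℝ) ^ k ≤ isoCount (k + 2) (F (k + 2)) := by exact_mod_cast h
    rw [pow_add]
    linarith
  · have h := (tendsto_pow_atTop_nhds_zero_of_lt_one (r := (7 / 8 : ℝ)) (by norm_num)
      (by norm_num)).const_mul 8
    rw [mul_zero] at h
    -- The quotient of the bounds is `8 (7/8)^n`.
    refine h.congr fun n => ?_
    rw [show (7 / 8 : ℝ) = (7 / 4) / 2 by norm_num, div_pow]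
    field_simp
    norm_num

end Counting

end Sedentary

theorem corollary6p5 :
    Sedentary.AlmostAll (fun _ G => Sedentary.IsCompleteMultipartite G)
      (fun _ G => Sedentary.HasSedentaryVertex G) ∧
    Sedentary.AlmostAll (fun _ G => Sedentary.IsConnectedThreshold G)
      (fun _ G => Sedentary.HasSedentaryVertex G) ∧
    Sedentary.AlmostAll (fun _ G => Sedentary.IsThreshold G)
      (fun _ G => Sedentary.HasSedentaryVertex G) :=
  ⟨Sedentary.almostAll_multipartite,
    Sedentary.almostAll_of_threshold_family (fun _ _ h => h) fun _ _ h => h.isThreshold,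
    Sedentary.almostAll_of_threshold_family (fun _ _ h => h.isThreshold) fun _ _ h => h⟩
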